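/- Let $G$ be a finite cyclic group of order $v$, written multiplicatively, and let $D\subseteq G$ be a non-trivial $(v,k,\lambda)$ difference set: $|D|=k$, every non-identity element of $G$ can be written as $xy^{-1}$ with $(x,y)\in D\times D$ in exactly $\lambda$ ways, and $k-\lambda>1$. An integer $t$ relatively prime to $\exp(G)=v$ is a (numerical) multiplier of $D$ if $\{x^t : x\in D\}=Dg$ for some $g\in G$; let $M(D)\le(\mathbb{Z}/v\mathbb{Z})^\times$ be the group of residue classes modulo $v$ of the multipliers of $D$. Let $\operatorname{rad}(v)$ be the product of the prime divisors of $v$, let $\varphi$ be Euler's totient function, and put $c_v=1$ if $8\nmid v$ and $c_v=2$ if $8\mid v$. (a) If $v\not\equiv 0\pmod 4$, then $M(D)$ is isomorphic to a subgroup of $(\mathbb{Z}/\operatorname{rad}(v)\mathbb{Z})^\times/\langle -1\rangle$, and $|M(D)|\le \varphi(\operatorname{rad}(v))/2$. (b) If $v\equiv 0\pmod 4$, then $M(D)$ is isomorphic to a subgroup of $(\mathbb{Z}/c_v\operatorname{rad}(v)\mathbb{Z})^\times$, and $|M(D)|\le c_v\,\varphi(\operatorname{rad}(v))$. -/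

import Mathlib

/-- A `(v, k, l)` difference set in an abelian group `G`: a `k`-subset `D` of `G`, with `G` of
order `v`, such that every non-identity element of `G` is a quotient `x * y⁻¹` of elements of `D`
in exactly `l` ways. -/
structure IsDifferenceSet {G : Type*} [CommGroup G] (D : Finset G) (v k l : ℕ) : Prop where
  card_group : Nat.card G = v
  card_set : D.card = k
  card_quotients : ∀ g : G, g ≠ 1 →
    {p : G × G | p.1 ∈ D ∧ p.2 ∈ D ∧ p.1 * p.2⁻¹ = g}.ncard = l

/-- An integer `t` is a numerical multiplier of `D` if it is relatively prime to the exponent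
of `G` and `D^(t) = {x ^ t | x ∈ D}` is a translate `D g` of `D`. -/
def IsMultiplier {G : Type*} [CommGroup G] (D : Finset G) (t : ℤ) : Prop :=
  IsCoprime t (Monoid.exponent G : ℤ) ∧
    ∃ g : G, (fun x : G => x ^ t) '' (D : Set G) = (fun x : G => x * g) '' (D : Set G)

theorem zpow_eq_zpow_of_zmod_exponent {G : Type*} [CommGroup G] {s t : ℤ}
    (h : (s : ZMod (Monoid.exponent G)) = (t : ZMod (Monoid.exponent G))) (x : G) :
    x ^ s = x ^ t := by
  rw [zpow_eq_zpow_iff_modEq]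
  rw [ZMod.intCast_eq_intCast_iff] at h
  exact h.of_dvd (Int.natCast_dvd_natCast.mpr (Monoid.order_dvd_exponent x))

theorem isCoprime_of_zmod_exponent {G : Type*} [CommGroup G] {t : ℤ}
    {u : (ZMod (Monoid.exponent G))ˣ} (h : (t : ZMod (Monoid.exponent G)) = u) :
    IsCoprime t (Monoid.exponent G : ℤ) := by
  rw [isCoprime_comm, ← ZMod.coe_int_isUnit_iff_isCoprime, h]
  exact u.isUnit

/-- The multiplier group `M(D)`: the numerical multipliers of `D`, taken modulo the exponent
of `G`, as a subgroup of the units of `ℤ / exp(G) ℤ`. -/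
def multiplierGroup {G : Type*} [CommGroup G] (D : Finset G) :
    Subgroup (ZMod (Monoid.exponent G))ˣ where
  carrier := {u | ∃ t : ℤ, (t : ZMod (Monoid.exponent G)) = (u : ZMod (Monoid.exponent G)) ∧
    IsMultiplier D t}
  one_mem' := ⟨1, by simp, isCoprime_one_left, 1, by simp⟩
  mul_mem' := by
    rintro a b ⟨s, hs, -, g, hg⟩ ⟨t, ht, -, h, hh⟩
    have e : ((s * t : ℤ) : ZMod (Monoid.exponent G)) = ((a * b : (ZMod (Monoid.exponent G))ˣ) :
        ZMod (Monoid.exponent G)) := by push_cast; rw [hs, ht]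
    refine ⟨s * t, e, isCoprime_of_zmod_exponent e, h * g ^ t, ?_⟩
    have e1 : (fun x : G => x ^ (s * t)) '' (D : Set G) =
        (fun x : G => x ^ t) '' ((fun x : G => x ^ s) '' (D : Set G)) := by
      rw [Set.image_image]; simp only [zpow_mul]
    have e2 : (fun x : G => x ^ t) '' ((fun x : G => x * g) '' (D : Set G)) =
        (fun x : G => x * g ^ t) '' ((fun x : G => x ^ t) '' (D : Set G)) := by
      rw [Set.image_image, Set.image_image]; simp only [mul_zpow]
    rw [e1, hg, e2, hh, Set.image_image]
    simp only [mul_assoc]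
  inv_mem' := by
    rintro a ⟨s, hs, -, g, hg⟩
    obtain ⟨t, ht⟩ := ZMod.intCast_surjective ((a⁻¹ : (ZMod (Monoid.exponent G))ˣ) :
      ZMod (Monoid.exponent G))
    refine ⟨t, ht, isCoprime_of_zmod_exponent ht, (g ^ t)⁻¹, ?_⟩
    have e : ((s * t : ℤ) : ZMod (Monoid.exponent G)) = ((1 : ℤ) : ZMod (Monoid.exponent G)) := by
      push_cast; rw [hs, ht, Units.mul_inv]
    have e1 : (fun x : G => x ^ t) '' ((fun x : G => x ^ s) '' (D : Set G)) = (D : Set G) := by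
      rw [Set.image_image]
      simp only [← zpow_mul, zpow_eq_zpow_of_zmod_exponent e, zpow_one, Set.image_id']
    have e2 : (fun x : G => x ^ t) '' ((fun x : G => x * g) '' (D : Set G)) =
        (fun x : G => x * g ^ t) '' ((fun x : G => x ^ t) '' (D : Set G)) := by
      rw [Set.image_image, Set.image_image]; simp only [mul_zpow]
    rw [hg, e2] at e1
    conv_rhs => rw [← e1]
    rw [Set.image_image]
    simp

/-- A unit lies in the multiplier group exactly when any integer representing it is a numerical
multiplier: the choice of representative does not matter. -/
theorem mem_multiplierGroup_iff {G : Type*} [CommGroup G] (D : Finset G)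
    {u : (ZMod (Monoid.exponent G))ˣ} {t : ℤ} (h : (t : ZMod (Monoid.exponent G)) = u) :
    u ∈ multiplierGroup D ↔ IsMultiplier D t := by
  constructor
  · rintro ⟨s, hs, -, g, hg⟩
    refine ⟨isCoprime_of_zmod_exponent h, g, ?_⟩
    rw [← hg]
    simp only [zpow_eq_zpow_of_zmod_exponent (h.trans hs.symm)]
  · exact fun ht => ⟨t, h, ht⟩

/-- The constant `c_m`: it is `1` if `8 ∤ m` and `2` otherwise. -/
def multiplierConst (m : ℕ) : ℕ := if 8 ∣ m then 2 else 1

/-! Write n = k - λ. Both parts amount to injectivity of reduction of `multiplierGroup D` modulo N,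
where N = rad(v) or N = c_v rad(v); in (a) one also needs that no multiplier reduces to -1.

Suppose a nontrivial multiplier reduces to 1. Some power of it has prime order p, and lifting
arguments give an integer t with t ≡ 1 modulo p and modulo v/p but not modulo v
(`dvd_prime_mul_sub_one`); the factor c_v = 2 serves the case p = 2 and 8 ∣ v. A double count of
points and translates shows that t fixes some translate of D (`exists_zpow_mul_eq`). The
endomorphism x ↦ x^(t-1) has kernel H of index p and image of order p inside H, so a t-orbit outside
H is a coset of that image. Hence the fixed translate is invariant, outside H, under some c ≠ 1 in
H. All failures of invariance, n of them, are therefore concentrated in H, and this is too many. If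
p ≥ 3, size estimates give n ≤ 1 (`order_le_one_of_two_mul_card_le`). If p = 2, the estimates leave
one tight case, in which n is a square and c exchanges D ∩ H with its complement in H; counting
changes of membership along the powers of a generator of H gives n ≡ 2 mod 4, which is impossible
(`order_le_one_of_two_mul_card_eq`).

If a multiplier reduces to -1, its square reduces to 1 and so is 1; for 4 ∤ v the multiplier is then
-1 itself. A translate fixed by inversion is excluded by the parity of the number of square roots
(`not_isMultiplier_neg_one`). -/

section

open Finset

/-! ### Correlations, and invariance outside a subgroup of index at least three -/

section Correlation

variable {G : Type*} [CommGroup G] [DecidableEq G]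

/-- The number of elements of `A` whose product with `g` lies in `A` as well. -/
def correlation (A : Finset G) (g : G) : ℕ := #{x ∈ A | g * x ∈ A}

theorem correlation_one (A : Finset G) : correlation A 1 = #A := by
  simp [correlation]

theorem card_filter_not_mem_eq (A : Finset G) (g : G) :
    (#{x ∈ A | g * x ∉ A} : ℤ) = #A - correlation A g := by
  have := Finset.card_filter_add_card_filter_not (s := A) (fun x => g * x ∈ A)
  simp only [correlation]
  omega

theorem IsDifferenceSet.correlation_eq {D : Finset G} {v k l : ℕ}
    (hD : IsDifferenceSet D v k l) {g : G} (hg : g ≠ 1) : correlation D g = l := by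
  rw [← hD.card_quotients g hg, correlation, ← Set.ncard_coe_finset]
  have : {p : G × G | p.1 ∈ D ∧ p.2 ∈ D ∧ p.1 * p.2⁻¹ = g} =
      (fun x => (g * x, x)) '' (({x ∈ D | g * x ∈ D} : Finset G) : Set G) := by
    ext ⟨a, b⟩
    simp only [Set.mem_ofPred_eq, Set.mem_image, coe_filter, Prod.mk.injEq]
    constructor
    · rintro ⟨ha, hb, rfl⟩
      exact ⟨b, ⟨hb, by simpa using ha⟩, by simp, rfl⟩
    · rintro ⟨x, ⟨hx, hgx⟩, rfl, rfl⟩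
      exact ⟨hgx, hx, by simp⟩
  rw [this, Set.ncard_image_of_injective]
  intro x y h
  exact (Prod.mk.inj h).2

/-- For an element of a subgroup `H`, correlations split into the part inside and the part
outside of `H`. -/
theorem correlation_eq_add (D : Finset G) (H : Subgroup G) [DecidablePred (· ∈ H)] {g : G}
    (hg : g ∈ H) :
    correlation D g = correlation {x ∈ D | x ∈ H} g + correlation {x ∈ D | x ∉ H} g := by
  simp only [correlation]
  rw [← Finset.card_union_of_disjoint]
  · congr 1
    ext x
    simp only [mem_filter, mem_union, H.mul_mem_cancel_left hg]
    tauto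
  · rw [Finset.disjoint_left]
    intro x hx hx'
    simp only [mem_filter] at hx hx'
    exact hx'.1.2 hx.1.2

/-- If `D` is invariant under a nontrivial `c ∈ H` outside of `H`, then `c` moves out of
`D` exactly `k - l` elements of `D ∩ H`. -/
theorem card_filter_not_mem_inter_eq {D : Finset G} {l : ℤ}
    (hl : ∀ g ≠ 1, (correlation D g : ℤ) = l) (H : Subgroup G) [DecidablePred (· ∈ H)]
    {c : G} (hc : c ∈ H) (hc1 : c ≠ 1) (hinv : ∀ x ∉ H, (c * x ∈ D ↔ x ∈ D)) :
    correlation {x ∈ D | x ∉ H} c = #{x ∈ D | x ∉ H} ∧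
    (#{x ∈ ({x ∈ D | x ∈ H} : Finset G) | c * x ∉ ({x ∈ D | x ∈ H} : Finset G)} : ℤ) = #D - l := by
  have h1 : correlation {x ∈ D | x ∉ H} c = #{x ∈ D | x ∉ H} := by
    rw [correlation]
    congr 1
    refine Finset.filter_true_of_mem fun x hx => ?_
    simp only [mem_filter] at hx ⊢
    exact ⟨(hinv x hx.2).2 hx.1, by rw [H.mul_mem_cancel_left hc]; exact hx.2⟩
  refine ⟨h1, ?_⟩
  have h2 := correlation_eq_add D H hc
  have h3 := hl c hc1
  have h4 := card_filter_not_mem_eq {x ∈ D | x ∈ H} c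
  have h5 := Finset.card_filter_add_card_filter_not (s := D) (fun x => x ∈ H)
  omega

variable [Fintype G]

theorem sum_correlation (A : Finset G) : ∑ g, correlation A g = #A * #A := by
  have h (g : G) : correlation A g = ∑ x ∈ A, if g * x ∈ A then 1 else 0 := by
    rw [correlation, Finset.card_filter]
  simp_rw [h]
  rw [Finset.sum_comm, ← smul_eq_mul, ← Finset.sum_const]
  refine Finset.sum_congr rfl fun x _ => ?_
  rw [Finset.sum_ite, Finset.sum_const_zero, add_zero, Finset.sum_const, smul_eq_mul, mul_one]
  refine Finset.card_bij (fun g _ => g * x) ?_ ?_ ?_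
  · intro g hg; simpa using hg
  · intro a _ b _ h; simpa using h
  · intro b hb; exact ⟨b * x⁻¹, by simpa using hb, by simp⟩

/-- Inclusion-exclusion. Complementation thus preserves constant correlation and the order n, which
allows the reduction to 2k ≤ v. -/
theorem correlation_compl (A : Finset G) (g : G) :
    (correlation Aᶜ g : ℤ) = Fintype.card G - 2 * #A + correlation A g := by
  have h1 : #({x | g * x ∈ A} : Finset G) = #A := by
    refine Finset.card_bij (fun x _ => g * x) ?_ ?_ ?_
    · intro x hx; simpa using hx
    · intro a _ b _ h; simpa using h
    · intro b hb; exact ⟨g⁻¹ * b, by simpa using hb, by simp⟩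
  have h2 : ({x ∈ Aᶜ | g * x ∈ Aᶜ} : Finset G) = (A ∪ ({x | g * x ∈ A} : Finset G))ᶜ := by
    ext x; simp
  have h3 : ({x ∈ A | g * x ∈ A} : Finset G) = A ∩ ({x | g * x ∈ A} : Finset G) := by
    ext x; simp
  have h4 := Finset.card_union_add_card_inter A ({x | g * x ∈ A} : Finset G)
  have h5 := Finset.card_add_card_compl (A ∪ ({x | g * x ∈ A} : Finset G))
  simp only [correlation]
  rw [h2, h3]
  omega

/-- The sum of the correlations of `A` over a subgroup outside of which they vanish. -/
theorem sum_correlation_subgroup (A : Finset G) (H : Subgroup G) [DecidablePred (· ∈ H)]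
    (h : ∀ g ∉ H, correlation A g = 0) :
    ∑ g with g ∈ H, correlation A g = #A * #A := by
  rw [← sum_correlation, Finset.sum_filter]
  refine Finset.sum_congr rfl fun g _ => ?_
  split_ifs with hg
  · rfl
  · exact (h g hg).symm

theorem sum_correlation_of_forall_eq {D : Finset G} {l : ℤ}
    (hl : ∀ g ≠ 1, (correlation D g : ℤ) = l) (H : Subgroup G) [DecidablePred (· ∈ H)] :
    ∑ g with g ∈ H, (correlation D g : ℤ) = #D - l + l * Nat.card H := by
  have h1 : (1 : G) ∈ ({g | g ∈ H} : Finset G) := by simp [H.one_mem]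
  rw [← Finset.add_sum_erase _ _ h1, correlation_one]
  rw [Finset.sum_congr rfl (g := fun _ => l) (fun g hg => hl g (Finset.ne_of_mem_erase hg))]
  have h2 : Nat.card H = #({g | g ∈ H} : Finset G) := by
    rw [Nat.card_eq_fintype_card, Fintype.card_subtype]
  have h3 := Finset.card_erase_add_one h1
  rw [Finset.sum_const, nsmul_eq_mul, h2, ← h3]
  push_cast
  ring

theorem card_sq_of_forall_correlation_eq {D : Finset G} {l : ℤ}
    (hl : ∀ g ≠ 1, (correlation D g : ℤ) = l) :
    (#D : ℤ) ^ 2 = #D - l + l * Fintype.card G := by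
  classical
  have := sum_correlation_of_forall_eq hl (⊤ : Subgroup G)
  rw [Subgroup.card_top, Nat.card_eq_fintype_card] at this
  rw [← this, sq, ← Nat.cast_mul, ← sum_correlation]
  simp

/-- The elements pushed out of `A` by `c` land in `H`, disjointly from `A`. -/
theorem card_add_card_filter_not_mem_le (A : Finset G) (H : Subgroup G) (c : G) (hc : c ∈ H)
    (hA : ∀ x ∈ A, x ∈ H) : #A + #{x ∈ A | c * x ∉ A} ≤ Nat.card H := by
  classical
  have h2 : Nat.card H = #({g | g ∈ H} : Finset G) := by
    rw [Nat.card_eq_fintype_card, Fintype.card_subtype]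
  have h3 : #(image (c * ·) {x ∈ A | c * x ∉ A}) = #{x ∈ A | c * x ∉ A} :=
    Finset.card_image_of_injective _ (mul_right_injective c)
  have h4 : Disjoint A (image (c * ·) {x ∈ A | c * x ∉ A}) := by
    rw [Finset.disjoint_left]
    intro x hx hx'
    simp only [mem_filter, mem_image] at hx'
    obtain ⟨y, ⟨_, hy⟩, rfl⟩ := hx'
    exact hy hx
  have h5 := Finset.card_union_of_disjoint h4
  have h6 : A ∪ image (c * ·) {x ∈ A | c * x ∉ A} ⊆
      ({g | g ∈ H} : Finset G) := by
    intro x hx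
    simp only [mem_union, mem_filter, mem_image, mem_univ, true_and] at hx ⊢
    rcases hx with hx | ⟨y, hy, rfl⟩
    · exact hA x hx
    · exact H.mul_mem hc (hA y hy.1)
  have h7 := Finset.card_le_card h6
  omega

/-- With m = |H| and k₀ = |D ∩ H|, the n elements moved by `c` give n ≤ k₀ and k₀ + n ≤ m, so 6n ≤
v. Summing correlations over `H` gives k₀² ≤ n + λm, hence 3n² ≤ 2n + k². The identity n(v-1) =
k(v-k) with 2k ≤ v and 6n ≤ v forces 4k ≤ v and then 3k ≤ 4n, so that 11n² ≤ 18n. -/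
theorem order_le_one_of_two_mul_card_le {D : Finset G} {l : ℤ}
    (hl : ∀ g ≠ 1, (correlation D g : ℤ) = l) (hk : 2 * #D ≤ Fintype.card G) (H : Subgroup G)
    (hH : 3 * Nat.card H ≤ Fintype.card G)
    {c : G} (hc : c ∈ H) (hc1 : c ≠ 1) (hinv : ∀ x ∉ H, (c * x ∈ D ↔ x ∈ D)) :
    (#D : ℤ) - l ≤ 1 := by
  classical
  have e1 := (card_filter_not_mem_inter_eq hl H hc hc1 hinv).2
  have e2 := card_add_card_filter_not_mem_le {x ∈ D | x ∈ H} H c hc (by simp)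
  have e3 := Finset.card_filter_le ({x ∈ D | x ∈ H} : Finset G)
    (fun x => c * x ∉ ({x ∈ D | x ∈ H} : Finset G))
  have e4 : (#{x ∈ D | x ∈ H} : ℤ) * #{x ∈ D | x ∈ H} ≤ #D - l + l * Nat.card H := by
    rw [← sum_correlation_of_forall_eq hl H, ← Nat.cast_mul,
      ← sum_correlation_subgroup {x ∈ D | x ∈ H} H, Nat.cast_sum]
    · refine Finset.sum_le_sum fun g hg => ?_
      rw [correlation_eq_add D H (by simpa using hg)]
      push_cast
      linarith [Nat.cast_nonneg (α := ℤ) (correlation {x ∈ D | x ∉ H} g)]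
    · intro g hg
      rw [correlation, Finset.card_eq_zero]
      refine Finset.filter_false_of_mem fun x hx => ?_
      simp only [mem_filter] at hx ⊢
      exact fun h => hg ((H.mul_mem_cancel_right hx.2).1 h.2)
  have e5 := card_sq_of_forall_correlation_eq hl
  have e6 : 0 ≤ l := by rw [← hl c hc1]; positivity
  generalize #({x ∈ ({x ∈ D | x ∈ H} : Finset G) | c * x ∉ ({x ∈ D | x ∈ H} : Finset G)}) = a at *
  generalize #({x ∈ D | x ∈ H} : Finset G) = k₀ at *
  generalize Nat.card H = m at *
  generalize Fintype.card G = v at *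
  generalize #D = k at *
  zify at *
  by_contra! hn
  obtain ⟨n, rfl⟩ : ∃ n, l = k - n := ⟨k - l, by ring⟩
  have f1 : (a : ℤ) = n := by linarith
  have f2 : (n : ℤ) * (v - 1) = k * (v - k) := by nlinarith
  have f3 : 3 * n ^ 2 ≤ 2 * n + (k : ℤ) ^ 2 := by nlinarith
  have f4 : 6 * n ≤ v := by linarith
  have hn2 : 2 ≤ n := by linarith
  have f5 : 4 * (k : ℤ) ≤ v := by
    by_contra! h
    nlinarith
  have f6 : 3 * (k : ℤ) ≤ 4 * n := by
    by_contra! h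
    nlinarith
  nlinarith

/-- A difference set invariant, outside of a subgroup `H` of index at least three, under a
nontrivial element of `H` is trivial. -/
theorem order_le_one_of_three_mul_card_le {D : Finset G} {l : ℤ}
    (hl : ∀ g ≠ 1, (correlation D g : ℤ) = l) (H : Subgroup G)
    (hH : 3 * Nat.card H ≤ Fintype.card G)
    {c : G} (hc : c ∈ H) (hc1 : c ≠ 1) (hinv : ∀ x ∉ H, (c * x ∈ D ↔ x ∈ D)) :
    (#D : ℤ) - l ≤ 1 := by
  rcases le_total (2 * #D) (Fintype.card G) with h | h
  · exact order_le_one_of_two_mul_card_le hl h H hH hc hc1 hinv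
  · have e := Finset.card_add_card_compl D
    have := order_le_one_of_two_mul_card_le (D := Dᶜ) (l := Fintype.card G - 2 * #D + l)
      (fun g hg => by rw [correlation_compl, hl g hg]) (by omega) H hH hc hc1
      (fun x hx => by simp [hinv x hx])
    omega

end Correlation

/-! ### Index two: the tight case and changes of membership along a cyclic subgroup -/

theorem eq_one_or_eq_pow_of_mul_self_eq_one {G : Type*} [CommGroup G] [Finite G] {h x : G} {m : ℕ}
    (hm : orderOf h = 2 * m) (hx : x ∈ Subgroup.zpowers h) (hxx : x * x = 1) :
    x = 1 ∨ x = h ^ m := by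
  obtain ⟨j, rfl⟩ := (mem_powers_iff_mem_zpowers.2 hx : x ∈ Submonoid.powers h)
  simp only [← pow_add] at hxx ⊢
  have h1 := orderOf_dvd_of_pow_eq_one hxx
  rw [hm, ← two_mul] at h1
  obtain ⟨q, rfl⟩ := Nat.dvd_of_mul_dvd_mul_left two_pos h1
  have h2 : h ^ (2 * m) = 1 := by rw [← hm, pow_orderOf_eq_one]
  obtain ⟨r, rfl | rfl⟩ := Nat.even_or_odd' q
  · left
    rw [mul_left_comm, ← mul_assoc, pow_mul, h2, one_pow]
  · right
    rw [mul_add, mul_left_comm, ← mul_assoc, pow_add, pow_mul, h2, one_pow, one_mul, mul_one]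

/-- A sequence changes its truth value an odd number of times exactly when its first and last
terms differ. -/
theorem odd_card_changes_iff (s : ℕ → Prop) [DecidablePred s] (n : ℕ) :
    Odd #{i ∈ range n | ¬ (s i ↔ s (i + 1))} ↔ ¬ (s 0 ↔ s n) := by
  induction n with
  | zero => simp
  | succ n ih =>
    rw [Finset.range_add_one, Finset.filter_insert]
    split_ifs with h
    · rw [ih]
      tauto
    · rw [Finset.card_insert_of_notMem (by simp), Nat.odd_add_one, ih]
      tauto

/-- By antiperiodicity a rise at i is a fall at i + n, so changes over a half period match falls
over a full one. -/
theorem card_changes_eq (s : ℕ → Prop) [DecidablePred s] (n : ℕ)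
    (hs : ∀ i, s (i + n) ↔ ¬ s i) :
    #{i ∈ range n | ¬ (s i ↔ s (i + 1))} = #{i ∈ range (n + n) | s i ∧ ¬ s (i + 1)} := by
  rw [Finset.card_filter, Finset.card_filter, Finset.sum_range_add, ← Finset.sum_add_distrib]
  refine Finset.sum_congr rfl fun i _ => ?_
  have h1 := hs i
  have h2 := hs (i + 1)
  rw [add_right_comm] at h2
  rw [add_comm n i]
  by_cases a : s i <;> by_cases b : s (i + 1) <;> simp [a, b, h1, h2]

/-- Here a = |D ∩ H|, w = |D \ H|, m = |H| and λ = a + w - n. Subtracting the equations gives 2aw =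
λm and n = (a - w)². Now n ≤ a yields m ≤ 2a, and a + n ≤ m yields 2a ≤ m; the degenerate cases w =
0 and w = m would make n = n². -/
theorem two_mul_eq_of_sq_eq {a w n m : ℤ} (hw : 0 ≤ w) (hm : 0 < m) (hn1 : 1 < n) (hna : n ≤ a)
    (hanm : a + n ≤ m) (hwm : w ≤ m) (h1 : a * a + w * w = n + (a + w - n) * m)
    (h2 : (a + w) ^ 2 = n + (a + w - n) * (2 * m)) :
    m = 2 * a ∧ a = n ∧ n = (a - w) * (a - w) := by
  have f1 : 2 * a * w = (a + w - n) * m := by linear_combination h2 - h1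
  have f2 : n = (a - w) * (a - w) := by linear_combination h2 - 2 * h1
  have hw0 : 0 < w := by
    refine lt_of_le_of_ne hw fun h => ?_
    subst h
    have h3 : a + 0 - n = 0 := by
      have : (a + 0 - n) * m = 0 := by linarith
      exact (mul_eq_zero.1 this).resolve_right hm.ne'
    obtain rfl : a = n := by linarith
    nlinarith
  have f3 : m ≤ 2 * a := by
    have : 0 ≤ (a - n) * m := mul_nonneg (by linarith) hm.le
    exact le_of_mul_le_mul_left (by linarith : w * m ≤ w * (2 * a)) hw0
  have hwm' : w < m := by
    refine lt_of_le_of_ne hwm fun h => ?_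
    subst h
    have h3 : a + n - w = 0 := by
      have : (a + n - w) * w = 0 := by linarith
      exact (mul_eq_zero.1 this).resolve_right hm.ne'
    obtain rfl : w = a + n := by linarith
    nlinarith
  have f4 : 2 * a ≤ m := by
    have : 0 ≤ m * (m - a - n) := mul_nonneg hm.le (by linarith)
    exact le_of_mul_le_mul_left (by linarith : (m - w) * (2 * a) ≤ (m - w) * m) (by linarith)
  have f5 : m = 2 * a := le_antisymm f3 f4
  refine ⟨f5, ?_, f2⟩
  have : a * (a - n) = 0 := by rw [f5] at f1; linarith
  rcases mul_eq_zero.1 this with h | h <;> linarith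

section IndexTwo

variable {G : Type*} [CommGroup G] [DecidableEq G] [Fintype G]

/-- In index two, quotients of elements in the same coset lie in `H`, so summing correlations over
`H` gives the sum of the squares of the two part sizes. Together with the sum over the whole group
this is the system solved by `two_mul_eq_of_sq_eq`. -/
theorem card_eq_of_two_mul_card_eq {D : Finset G} {l : ℤ}
    (hl : ∀ g ≠ 1, (correlation D g : ℤ) = l) (H : Subgroup G) [DecidablePred (· ∈ H)]
    (hH : 2 * Nat.card H = Fintype.card G)
    {c : G} (hc : c ∈ H) (hc1 : c ≠ 1) (hinv : ∀ x ∉ H, (c * x ∈ D ↔ x ∈ D))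
    (hn : 1 < (#D : ℤ) - l) :
    Nat.card H = 2 * #{x ∈ D | x ∈ H} ∧ (#{x ∈ D | x ∈ H} : ℤ) = #D - l ∧
      correlation {x ∈ D | x ∈ H} c = 0 ∧ IsSquare ((#D : ℤ) - l) := by
  have hidx : H.index = 2 := by
    have h1 := H.card_mul_index
    rw [Nat.card_eq_fintype_card (α := G), ← hH, mul_comm] at h1
    exact Nat.eq_of_mul_eq_mul_right Nat.card_pos h1
  obtain ⟨e0, e1⟩ := card_filter_not_mem_inter_eq hl H hc hc1 hinv
  have e2 := card_add_card_filter_not_mem_le {x ∈ D | x ∈ H} H c hc (by simp)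
  have e3 := Finset.card_filter_le ({x ∈ D | x ∈ H} : Finset G)
    (fun x => c * x ∉ ({x ∈ D | x ∈ H} : Finset G))
  have e4 : (#{x ∈ D | x ∈ H} : ℤ) * #{x ∈ D | x ∈ H} +
      (#{x ∈ D | x ∉ H} : ℤ) * #{x ∈ D | x ∉ H} = #D - l + l * Nat.card H := by
    rw [← sum_correlation_of_forall_eq hl H, ← Nat.cast_mul, ← Nat.cast_mul,
      ← sum_correlation_subgroup {x ∈ D | x ∈ H} H, ← sum_correlation_subgroup {x ∈ D | x ∉ H} H,
      Nat.cast_sum, Nat.cast_sum, ← Finset.sum_add_distrib]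
    · refine Finset.sum_congr rfl fun g hg => ?_
      rw [correlation_eq_add D H (by simpa using hg), Nat.cast_add]
    · intro g hg
      rw [correlation, Finset.card_eq_zero]
      refine Finset.filter_false_of_mem fun x hx => ?_
      simp only [mem_filter, Subgroup.mul_mem_iff_of_index_two hidx] at hx ⊢
      tauto
    · intro g hg
      rw [correlation, Finset.card_eq_zero]
      refine Finset.filter_false_of_mem fun x hx => ?_
      simp only [mem_filter, Subgroup.mul_mem_iff_of_index_two hidx] at hx ⊢
      tauto
  have e5 := card_sq_of_forall_correlation_eq hl
  have e6 := correlation_eq_add D H hc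
  have e7 := hl c hc1
  have e8 : #{x ∈ D | x ∈ H} + #{x ∈ D | x ∉ H} = #D :=
    Finset.card_filter_add_card_filter_not _
  have e9 : 0 < Nat.card H := Nat.card_pos
  have e10 : #{x ∈ D | x ∉ H} + Nat.card H ≤ Fintype.card G := by
    rw [Nat.card_eq_fintype_card, Fintype.card_subtype, ← Finset.card_union_of_disjoint]
    · exact Finset.card_le_univ _
    · rw [Finset.disjoint_left]
      simp
  generalize correlation {x ∈ D | x ∈ H} c = r at *
  generalize correlation {x ∈ D | x ∉ H} c = r' at *
  generalize #({x ∈ ({x ∈ D | x ∈ H} : Finset G) | c * x ∉ ({x ∈ D | x ∈ H} : Finset G)}) = b at *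
  generalize #({x ∈ D | x ∈ H} : Finset G) = a at *
  generalize #({x ∈ D | x ∉ H} : Finset G) = w at *
  generalize Nat.card H = m at *
  generalize Fintype.card G = v at *
  generalize #D = k at *
  zify at *
  obtain ⟨n, rfl⟩ : ∃ n, l = k - n := ⟨k - l, by ring⟩
  have hk : (k : ℤ) = a + w := e8.symm
  rw [hk] at e4 e5
  rw [← hH] at e5
  obtain ⟨f5, f6, f7⟩ := two_mul_eq_of_sq_eq (a := a) (w := w) (n := n) (m := m) (by positivity) e9
    (by linarith) (by linarith) (by linarith) (by linarith) (by linear_combination e4)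
    (by linear_combination e5)
  refine ⟨f5, by linarith, by linarith, (a : ℤ) - w, by linarith⟩

/-- A difference set in an abelian group cannot be invariant, outside of a cyclic subgroup `H` of
index two, under the involution of `H`, unless it is trivial. -/
theorem order_le_one_of_two_mul_card_eq {D : Finset G} {l : ℤ}
    (hl : ∀ g ≠ 1, (correlation D g : ℤ) = l) (h : G)
    (hH : 2 * orderOf h = Fintype.card G)
    {c : G} (hc : c ∈ Subgroup.zpowers h) (hc1 : c ≠ 1) (hcc : c * c = 1)
    (hinv : ∀ x ∉ Subgroup.zpowers h, (c * x ∈ D ↔ x ∈ D)) :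
    (#D : ℤ) - l ≤ 1 := by
  classical
  by_contra! hn
  set H := Subgroup.zpowers h with hHdef
  obtain ⟨e1, e2, e3, e4⟩ := card_eq_of_two_mul_card_eq hl H
    (by rw [hHdef, Nat.card_zpowers, hH]) hc hc1 hinv hn
  have e0 := (card_filter_not_mem_inter_eq hl H hc hc1 hinv).1
  set A : Finset G := {x ∈ D | x ∈ H} with hA
  have hord : orderOf h = 2 * #A := by rw [← e1, hHdef, Nat.card_zpowers]
  have hch : c = h ^ #A := (eq_one_or_eq_pow_of_mul_self_eq_one hord hc hcc).resolve_left hc1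
  have hh : h ∈ H := Subgroup.mem_zpowers h
  have hdis (x : G) (hx : x ∈ D) (hxH : x ∈ H) : c * x ∉ D := by
    rw [correlation, Finset.card_eq_zero, Finset.filter_eq_empty_iff] at e3
    intro hcx
    exact e3 (mem_filter.2 ⟨hx, hxH⟩) (mem_filter.2 ⟨hcx, H.mul_mem hc hxH⟩)
  have hmem (x : G) (hxH : x ∈ H) : c * x ∈ D ↔ x ∉ D := by
    refine ⟨fun h1 h2 => hdis x h2 hxH h1, fun h1 => ?_⟩
    have h3 : A ∪ A.image (c * ·) = ({g | g ∈ H} : Finset G) := by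
      refine Finset.eq_of_subset_of_card_le ?_ ?_
      · intro y hy
        simp only [mem_union, hA, mem_filter, mem_image, mem_univ, true_and] at hy ⊢
        rcases hy with hy | ⟨z, hz, rfl⟩
        · exact hy.2
        · exact H.mul_mem hc hz.2
      · rw [Finset.card_union_of_disjoint, Finset.card_image_of_injective _ (mul_right_injective c),
          ← two_mul, ← e1, Nat.card_eq_fintype_card, Fintype.card_subtype]
        rw [Finset.disjoint_left]
        intro y hy hy'
        simp only [hA, mem_filter, mem_image] at hy hy'
        obtain ⟨z, hz, rfl⟩ := hy'
        exact hdis z hz.1 hz.2 hy.1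
    have h4 : x ∈ A ∪ A.image (c * ·) := by rw [h3]; simpa using hxH
    simp only [mem_union, hA, mem_filter, mem_image] at h4
    rcases h4 with h4 | ⟨z, hz, rfl⟩
    · exact absurd h4.1 h1
    · rw [← mul_assoc, hcc, one_mul]
      exact hz.1
  have hh1 : h ≠ 1 := by
    rintro rfl
    rw [orderOf_one] at hord
    omega
  have hch1 : c * h ≠ 1 := by
    rw [hch, ← pow_succ]
    intro h1
    have := Nat.le_of_dvd (by omega) (orderOf_dvd_of_pow_eq_one h1)
    omega
  -- Both full correlations equal λ, and the parts outside `H` agree by invariance under `c`.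
  have r1 : correlation A h = correlation A (c * h) := by
    have h1 := correlation_eq_add D H hh
    have h2 := correlation_eq_add D H (H.mul_mem hc hh)
    have h3 := hl h hh1
    have h4 := hl _ hch1
    rw [← hA] at h1 h2
    have h5 : correlation {x ∈ D | x ∉ H} h = correlation {x ∈ D | x ∉ H} (c * h) := by
      simp only [correlation]
      congr 1
      refine Finset.filter_congr fun x hx => ?_
      simp only [mem_filter] at hx ⊢
      rw [mul_assoc, H.mul_mem_cancel_left hc]
      refine and_congr_left fun hhx => (hinv _ hhx).symm
    omega
  -- Since `c` exchanges `A` and `H \ A`, this and `r1` make `#A` twice the number of falls along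
  -- the powers of `h`.
  have r2 : correlation A (c * h) = #{x ∈ A | h * x ∉ A} := by
    simp only [correlation]
    congr 1
    refine Finset.filter_congr fun x hx => ?_
    simp only [hA, mem_filter] at hx ⊢
    have hhx := H.mul_mem hh hx.2
    rw [mul_assoc, H.mul_mem_cancel_left hc, hmem _ hhx]
    simp [hhx]
  have r3 := card_filter_not_mem_eq A h
  have r4 : #{x ∈ A | h * x ∉ A} = #{i ∈ range (#A + #A) | h ^ i ∈ D ∧ ¬ h ^ (i + 1) ∈ D} := by
    symm
    have hpow (i : ℕ) : h ^ i ∈ H := H.pow_mem hh i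
    refine Finset.card_bij (fun i _ => h ^ i) ?_ ?_ ?_
    · intro i hi
      simp only [mem_filter, hA, ← pow_succ', hpow] at hi ⊢
      simpa using hi.2
    · intro i hi j hj hij
      simp only [mem_filter, mem_range, ← two_mul, ← hord] at hi hj
      exact pow_injOn_Iio_orderOf hi.1 hj.1 hij
    · intro x hx
      simp only [mem_filter, hA] at hx
      obtain ⟨i, hi, rfl⟩ := Finset.mem_image.1 (mem_zpowers_iff_mem_range_orderOf.1 hx.1.2)
      refine ⟨i, ?_, rfl⟩
      simp only [mem_filter, ← two_mul, ← hord, hi, true_and, pow_succ']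
      exact ⟨hx.1.1, fun h1 => hx.2 ⟨h1, H.mul_mem hh hx.1.2⟩⟩
  have r5 := card_changes_eq (fun i => h ^ i ∈ D) #A fun i => by
    rw [add_comm, pow_add, ← hch]
    exact hmem _ (H.pow_mem hh i)
  have r6 := (odd_card_changes_iff (fun i => h ^ i ∈ D) #A).2 (by
    have := hmem 1 H.one_mem
    rw [mul_one, hch] at this
    rw [this, pow_zero]
    tauto)
  rw [r5, ← r4] at r6
  obtain ⟨q, hq⟩ := e4
  rw [← e2] at hq
  obtain ⟨j, hj⟩ := r6
  -- The number of falls is the odd number 2j + 1, while `#A` = n = q².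
  have h7 : (#A : ℤ) = 4 * j + 2 := by omega
  rcases Int.even_or_odd' q with ⟨s, rfl | rfl⟩
  · have : 4 * (s * s) = 4 * (j : ℤ) + 2 := by linarith
    omega
  · have : 4 * (s * s) + 4 * s + 1 = 4 * (j : ℤ) + 2 := by linarith
    omega

end IndexTwo

/-! ### A translate fixed by a given multiplier -/

section Translate

variable {G : Type*} [CommGroup G] [DecidableEq G] [Fintype G]

/-- Viewed as a design, this counts the blocks `D y` through both points `a` and `b`. -/
theorem card_filter_mul_inv_mem (D : Finset G) (a b : G) :
    #({y | a * y⁻¹ ∈ D ∧ b * y⁻¹ ∈ D} : Finset G) = correlation D (b * a⁻¹) := by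
  refine Finset.card_bij (fun y _ => a * y⁻¹) ?_ ?_ ?_
  · intro y hy
    simpa [← mul_assoc] using hy
  · intro x _ y _ h
    simpa using h
  · intro x hx
    have h : (a * x⁻¹)⁻¹ = a⁻¹ * x := by rw [mul_inv, inv_inv]
    refine ⟨a * x⁻¹, ?_, by simp⟩
    rw [mem_filter, h, ← mul_assoc, ← mul_assoc, mul_inv_cancel, one_mul]
    exact ⟨mem_univ _, mem_filter.1 hx⟩

/-- An automorphism `x ↦ x ^ t` of `G` taking a nontrivial difference set to one of its translates
fixes one of its translates. -/
theorem exists_zpow_mul_eq {D : Finset G} {l : ℤ}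
    (hl : ∀ g ≠ 1, (correlation D g : ℤ) = l) (hn : 0 < (#D : ℤ) - l) {t : ℤ}
    (ht : Function.Bijective (fun x : G => x ^ t)) {g : G}
    (hg : (fun x : G => x ^ t) '' (D : Set G) = (fun x : G => x * g) '' (D : Set G)) :
    ∃ y : G, y ^ t * g = y := by
  have hmem (x : G) : x ∈ D ↔ x ^ t * g⁻¹ ∈ D := by
    have : x ∈ D ↔ x ^ t ∈ (fun x : G => x ^ t) '' (D : Set G) := by
      rw [ht.1.mem_set_image (a := x), mem_coe]
    rw [this, hg]
    simp only [Set.mem_image, mem_coe]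
    constructor
    · rintro ⟨z, hz, h⟩
      rwa [← h, mul_inv_cancel_right]
    · intro h
      exact ⟨_, h, by simp⟩
  by_contra! hne
  -- Count pairs (x, y) with x and x^t both in the block `D y`. For fixed y the condition says that
  -- x^t lies in the blocks indexed by y^t g and y.
  have e1 : ∑ x : G, correlation D (x ^ t * x⁻¹) = ∑ y : G, correlation D (y ^ t * g * y⁻¹) := by
    have e2 (y : G) : correlation D (y ^ t * g * y⁻¹) =
        #({x | x * y⁻¹ ∈ D ∧ x ^ t * y⁻¹ ∈ D} : Finset G) := by
      have h1 (x : G) : (x * y⁻¹) ^ t * g⁻¹ = x ^ t * (y ^ t * g)⁻¹ := by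
        rw [mul_zpow, inv_zpow, mul_inv, mul_assoc]
      have h2 (w u : G) : u * y⁻¹ * (w * u⁻¹) = w * y⁻¹ := by
        rw [mul_comm, mul_assoc, inv_mul_cancel_left]
      symm
      refine Finset.card_bij (fun x _ => x ^ t * (y ^ t * g)⁻¹) ?_ ?_ ?_
      · intro x hx
        rw [mem_filter, hmem (x * y⁻¹), h1] at hx
        rw [mem_filter, h2]
        exact hx.2
      · intro a _ b _ h
        exact ht.1 (mul_right_cancel h)
      · intro z hz
        obtain ⟨x, hx⟩ := ht.2 (z * (y ^ t * g))
        simp only at hx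
        have h3 : x ^ t * (y ^ t * g)⁻¹ = z := by rw [hx, mul_inv_cancel_right]
        refine ⟨x, ?_, h3⟩
        rw [mem_filter, hmem (x * y⁻¹), h1, ← h2 _ (y ^ t * g), h3]
        exact ⟨mem_univ _, mem_filter.1 hz⟩
    simp_rw [e2, ← card_filter_mul_inv_mem, Finset.card_filter]
    exact Finset.sum_comm
  have e3 : ∑ y : G, (correlation D (y ^ t * g * y⁻¹) : ℤ) = ∑ y : G, l := by
    refine Finset.sum_congr rfl fun y _ => hl _ fun h => hne y ?_
    exact mul_inv_eq_one.1 h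
  -- The identity is a fixed point, so it contributes k > λ.
  have e4 : ∑ y : G, l < ∑ x : G, (correlation D (x ^ t * x⁻¹) : ℤ) := by
    refine Finset.sum_lt_sum (fun x _ => ?_) ⟨1, mem_univ _, ?_⟩
    · by_cases h : x ^ t * x⁻¹ = 1
      · rw [h, correlation_one]
        linarith
      · exact (hl _ h).ge
    · simp only [one_zpow, inv_one, mul_one, correlation_one]
      linarith
  rw [← e3] at e4
  exact absurd (by exact_mod_cast e1) e4.ne'

/-- A nontrivial difference set has a translate fixed by a given multiplier. -/
theorem IsMultiplier.exists_fixed_translate {D : Finset G} {l : ℤ}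
    (hl : ∀ g ≠ 1, (correlation D g : ℤ) = l) (hn : 0 < (#D : ℤ) - l) {t : ℤ}
    (ht : IsMultiplier D t) :
    ∃ D' : Finset G, #D' = #D ∧ (∀ g ≠ 1, (correlation D' g : ℤ) = l) ∧
      ∀ x ∈ D', x ^ t ∈ D' := by
  obtain ⟨hco, g, hg⟩ := ht
  have hinj : Function.Injective (fun x : G => x ^ t) := by
    obtain ⟨a, b, hab⟩ := hco
    refine Function.LeftInverse.injective (g := fun x => x ^ a) fun x => ?_
    have h1 : t * a = 1 - Monoid.exponent G * b := by linear_combination hab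
    simp only
    rw [← zpow_mul, h1, zpow_sub, zpow_one, zpow_mul, zpow_natCast, Monoid.pow_exponent_eq_one,
      one_zpow, inv_one, mul_one]
  obtain ⟨y, hy⟩ := exists_zpow_mul_eq hl hn (Finite.injective_iff_bijective.1 hinj) hg
  have hmem (x : G) : x ∈ D.image (· * y) ↔ x * y⁻¹ ∈ D := by
    rw [mem_image]
    exact ⟨by rintro ⟨z, hz, rfl⟩; simpa using hz, fun h => ⟨_, h, by simp⟩⟩
  refine ⟨D.image (· * y), Finset.card_image_of_injective _ (mul_left_injective y), ?_, ?_⟩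
  · intro u hu
    rw [← hl u hu]
    congr 1
    symm
    refine Finset.card_bij (fun x _ => x * y) ?_ ?_ ?_
    · intro x hx
      rw [mem_filter] at hx ⊢
      rw [hmem, hmem, ← mul_assoc, mul_inv_cancel_right, mul_inv_cancel_right]
      exact hx
    · intro a _ b _ h
      exact mul_right_cancel h
    · intro x hx
      rw [mem_filter, hmem, hmem, mul_assoc] at hx
      exact ⟨x * y⁻¹, mem_filter.2 hx, by simp⟩
  · intro x hx
    rw [mem_image] at hx ⊢
    obtain ⟨d, hd, rfl⟩ := hx
    have h1 : d ^ t ∈ (fun x : G => x * g) '' (D : Set G) := by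
      rw [← hg]
      exact ⟨d, hd, rfl⟩
    obtain ⟨e, he, h2⟩ := h1
    refine ⟨e, he, ?_⟩
    rw [mul_zpow, ← h2]
    conv_lhs => rw [← hy]
    simp only [mul_assoc, mul_comm g]

end Translate

/-! ### Difference sets fixed by inversion -/

section Inversion

variable {G : Type*} [CommGroup G] [DecidableEq G]

/-- For a symmetric set, the parity of a correlation is the parity of the number of square
roots in the set. -/
theorem natCast_card_filter_mul_self {D : Finset G} {l : ℤ}
    (hl : ∀ g ≠ 1, (correlation D g : ℤ) = l) (hD : ∀ x ∈ D, x⁻¹ ∈ D) {g : G} (hg : g ≠ 1) :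
    (#{x ∈ D | x * x = g} : ZMod 2) = l := by
  have h1 : correlation D g = #{x ∈ D | g * x⁻¹ ∈ D} := by
    refine Finset.card_bij (fun x _ => x⁻¹) ?_ ?_ ?_
    · intro x hx
      simp only [mem_filter, inv_inv] at hx ⊢
      exact ⟨hD x hx.1, hx.2⟩
    · intro x _ y _ h
      exact inv_injective h
    · intro x hx
      simp only [mem_filter] at hx
      exact ⟨x⁻¹, mem_filter.2 ⟨hD x hx.1, hx.2⟩, inv_inv x⟩
  -- The involution x ↦ g x⁻¹ pairs off everything except the square roots of g.
  have h2 : ∑ x ∈ D with g * x⁻¹ ∈ D, (if x * x = g then 0 else 1 : ZMod 2) = 0 := by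
    have h3 (x : G) : g * x⁻¹ * (g * x⁻¹) = g ↔ x * x = g := by
      rw [mul_mul_mul_comm, ← mul_inv, mul_assoc, mul_eq_left, mul_inv_eq_one, eq_comm]
    refine Finset.sum_involution (fun x _ => g * x⁻¹) ?_ ?_ ?_ ?_
    · intro x _
      simp only [h3]
      split_ifs
      · simp
      · exact CharTwo.add_self_eq_zero 1
    · intro x _ hx h
      refine hx (if_pos ?_)
      rw [mul_inv_eq_iff_eq_mul] at h
      exact h.symm
    · intro x hx
      simp only [mem_filter] at hx ⊢
      exact ⟨hx.2, by simpa using hx.1⟩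
    · intro x _
      simp
  rw [← hl g hg, h1, Int.cast_natCast, ← Finset.card_filter_add_card_filter_not
    (s := {x ∈ D | g * x⁻¹ ∈ D}) (fun x => x * x = g), Nat.cast_add]
  have h4 : (#{x ∈ ({x ∈ D | g * x⁻¹ ∈ D} : Finset G) | ¬ x * x = g} : ZMod 2) = 0 := by
    rw [← h2, Finset.card_filter, Nat.cast_sum]
    refine Finset.sum_congr rfl fun x _ => ?_
    split_ifs <;> simp
  rw [h4, add_zero, Finset.filter_filter]
  congr 2
  refine Finset.filter_congr fun x hx => ?_
  constructor
  · rintro rfl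
    simpa using hx
  · exact fun h => h.2

variable [Fintype G]

/-- Squaring is bijective, so the parity of λ alone decides membership of every y ≠ 1; such a set is
trivial. -/
theorem order_le_one_of_forall_inv_mem_of_odd {D : Finset G} {l : ℤ}
    (hl : ∀ g ≠ 1, (correlation D g : ℤ) = l) (hD : ∀ x ∈ D, x⁻¹ ∈ D)
    (hodd : Odd (Fintype.card G)) {c : G} (hc : c ≠ 1) : (#D : ℤ) - l ≤ 1 := by
  have hinj : Function.Injective (fun x : G => x * x) := by
    have := (Nat.Coprime.pow_left_bijective (G := G) (n := 2)
      (by rw [Nat.card_eq_fintype_card]; exact hodd.coprime_two_right)).1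
    simpa only [sq] using this
  have h1 (y : G) (hy : y ≠ 1) : ((if y ∈ D then 1 else 0 : ℕ) : ZMod 2) = l := by
    rw [← natCast_card_filter_mul_self hl hD (g := y * y) fun h => hy (hinj (by simpa using h))]
    congr 1
    rw [← Finset.card_singleton y, ← Finset.card_empty (α := G), ← apply_ite]
    congr 1
    ext x
    rw [mem_filter, hinj.eq_iff (a := x), Iff.comm]
    split_ifs with h
    · rw [mem_singleton]
      exact ⟨fun h => h.2, fun h' => ⟨h' ▸ h, h'⟩⟩
    · simp only [notMem_empty, iff_false]
      rintro ⟨h', rfl⟩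
      exact h h'
  have h2 (y z : G) (hy : y ≠ 1) (hz : z ≠ 1) (hyD : y ∈ D) : z ∈ D := by
    have := (h1 y hy).trans (h1 z hz).symm
    by_contra hzD
    simp [hyD, hzD] at this
  rw [← hl c hc, ← card_filter_not_mem_eq]
  norm_cast
  refine Finset.card_le_one.2 fun x hx y hy => ?_
  simp only [mem_filter] at hx hy
  have h3 (z : G) (hz : z ∈ D ∧ c * z ∉ D) (hz1 : z ≠ 1) : c * z = 1 := by
    by_contra h
    exact hz.2 (h2 z _ hz1 h hz.1)
  have h4 (z w : G) (hz : z ∈ D ∧ c * z ∉ D) (hw : w ∈ D ∧ c * w ∉ D) (hz1 : z ≠ 1)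
      (hw1 : w = 1) : False := by
    rw [hw1, mul_one] at hw
    exact hw.2 (h2 z c hz1 hc hz.1)
  by_cases hx1 : x = 1 <;> by_cases hy1 : y = 1
  · rw [hx1, hy1]
  · exact (h4 y x hy hx hy1 hx1).elim
  · exact (h4 x y hx hy hx1 hy1).elim
  · exact mul_left_cancel ((h3 x hx hx1).trans (h3 y hy hy1).symm)

/-- A generator has no square root, so λ is even. The square roots of y² are y and cy, with c the
involution, so parity makes `D` invariant under c away from 1 and c. -/
theorem order_le_one_of_forall_inv_mem_of_even {D : Finset G} {l : ℤ}
    (hl : ∀ g ≠ 1, (correlation D g : ℤ) = l) (hD : ∀ x ∈ D, x⁻¹ ∈ D)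
    {h : G} (hh : ∀ x, x ∈ Subgroup.zpowers h) {m : ℕ} (hm : orderOf h = 2 * m) :
    (#D : ℤ) - l ≤ 1 := by
  have hm0 : 0 < m := by
    have := orderOf_pos h
    omega
  have h1 : h ≠ 1 := by
    rintro rfl
    rw [orderOf_one] at hm
    omega
  set c := h ^ m with hcdef
  have hcc : c * c = 1 := by rw [hcdef, ← pow_add, ← two_mul, ← hm, pow_orderOf_eq_one]
  have hc : c ≠ 1 := by
    intro hc
    have := Nat.le_of_dvd hm0 (orderOf_dvd_of_pow_eq_one hc)
    omega
  have hinv (x : G) (hx : x * x = 1) : x = 1 ∨ x = c :=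
    eq_one_or_eq_pow_of_mul_self_eq_one hm (hh x) hx
  have hl0 : (l : ZMod 2) = 0 := by
    rw [← natCast_card_filter_mul_self hl hD h1, Finset.filter_false_of_mem]
    · simp
    · intro x _ hx
      obtain ⟨j, rfl⟩ := Subgroup.mem_zpowers_iff.1 (hh x)
      rw [← zpow_add, ← mul_inv_eq_one, ← zpow_sub_one, ← orderOf_dvd_iff_zpow_eq_one, hm] at hx
      obtain ⟨q, hq⟩ := hx
      push_cast at hq
      rw [mul_assoc] at hq
      omega
  have key (y : G) (hy1 : y ≠ 1) (hyc : y ≠ c) (hyD : y ∈ D) : c * y ∈ D := by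
    by_contra hcy
    have h2 : y * y ≠ 1 := fun h2 => (hinv y h2).elim hy1 hyc
    have h3 := natCast_card_filter_mul_self hl hD h2
    have h4 : ({x ∈ D | x * x = y * y} : Finset G) = {y} := by
      ext x
      simp only [mem_filter, mem_singleton]
      constructor
      · rintro ⟨hx, hxy⟩
        have : (x * y⁻¹) * (x * y⁻¹) = 1 := by
          rw [mul_mul_mul_comm, hxy, ← mul_inv, mul_inv_cancel]
        rcases hinv _ this with h5 | h5
        · exact mul_inv_eq_one.1 h5
        · rw [mul_inv_eq_iff_eq_mul] at h5
          exact absurd (h5 ▸ hx) hcy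
      · rintro rfl
        exact ⟨hyD, rfl⟩
    rw [h4, hl0] at h3
    simp at h3
  rw [← hl c hc, ← card_filter_not_mem_eq]
  norm_cast
  refine Finset.card_le_one.2 fun x hx y hy => ?_
  simp only [mem_filter] at hx hy
  have h3 (z : G) (hz : z ∈ D ∧ c * z ∉ D) : z = 1 ∨ z = c := by
    by_contra! h
    exact hz.2 (key z h.1 h.2 hz.1)
  have h4 (hw : (1 : G) ∈ D ∧ c * 1 ∉ D) (hz : c ∈ D ∧ c * c ∉ D) : False :=
    hw.2 (by simpa using hz.1)
  rcases h3 x hx with rfl | rfl <;> rcases h3 y hy with h5 | h5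
  · exact h5.symm
  · rw [h5] at hy
    exact (h4 hx hy).elim
  · rw [h5] at hy
    exact (h4 hy hx).elim
  · exact h5.symm

end Inversion

/-! ### Arithmetic of residues of prime order -/

theorem isCoprime_natCast_of_forall_prime {x : ℤ} {v : ℕ}
    (h : ∀ q : ℕ, q.Prime → q ∣ v → ¬ (q : ℤ) ∣ x) : IsCoprime x v := by
  rw [Int.isCoprime_iff_gcd_eq_one, Int.gcd_def, Int.natAbs_natCast]
  by_contra hne
  obtain ⟨q, hq, h1, h2⟩ := Nat.Prime.not_coprime_iff_dvd.1 hne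
  exact h q hq h2 (Int.natCast_dvd.2 h1)

theorem dvd_geom_sum_sub {m t : ℤ} (h : m ∣ t - 1) (p : ℕ) :
    m ∣ ∑ i ∈ range p, t ^ i - p := by
  have h1 : (∑ i ∈ range p, t ^ i - p : ℤ) = ∑ i ∈ range p, (t ^ i - 1) := by
    rw [Finset.sum_sub_distrib]
    simp
  rw [h1]
  refine Finset.dvd_sum fun i _ => h.trans ?_
  simpa using sub_dvd_pow_sub_pow t 1 i

/-- An integer congruent to `1` modulo the prime divisors of `v` whose residue modulo `v` has
prime order `p` is congruent to `1` modulo `v / p`. -/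
theorem dvd_prime_mul_sub_one {v p : ℕ} (hv : v ≠ 0) (hp : p.Prime) {t : ℤ}
    (hrad : ∀ q : ℕ, q.Prime → q ∣ v → (q : ℤ) ∣ t - 1) (h8 : 8 ∣ v → (4 : ℤ) ∣ t - 1)
    (htp : (v : ℤ) ∣ t ^ p - 1) (ht : ¬ (v : ℤ) ∣ t - 1) :
    (v : ℤ) ∣ p * (t - 1) ∧ (p : ℤ) ∣ t - 1 := by
  rw [← geom_sum_mul] at htp
  -- The sum is t^p - 1 divided by t - 1, and it is congruent to p modulo q.
  have key (q : ℕ) (hq : q.Prime) (hqv : q ∣ v) (hqS : (q : ℤ) ∣ ∑ i ∈ range p, t ^ i) : q = p := by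
    have h1 := (dvd_sub_right hqS).1 (dvd_geom_sum_sub (hrad q hq hqv) p)
    exact (Nat.prime_dvd_prime_iff_eq hq hp).1 (Int.natCast_dvd_natCast.1 h1)
  have hpv : p ∣ v := by
    by_contra hpv
    refine ht ((isCoprime_natCast_of_forall_prime fun q hq hqv hqS => ?_).symm.dvd_of_dvd_mul_left
      htp)
    exact hpv (key q hq hqv hqS ▸ hqv)
  have hpt := hrad p hp hpv
  refine ⟨?_, hpt⟩
  -- Only here can the sum fail to be p modulo p², since t ≡ 1 mod 4 is not available; but then the
  -- 2-part of v is at most 4, and t ≡ 1 modulo 2w suffices.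
  by_cases h2 : p = 2 ∧ ¬ 8 ∣ v
  · obtain ⟨rfl, h8v⟩ := h2
    obtain ⟨a, w, hw, rfl⟩ := Nat.exists_eq_two_pow_mul_odd hv
    have ha : a < 3 := by
      by_contra! ha
      exact h8v (dvd_mul_of_dvd_left (pow_dvd_pow 2 ha) w)
    have hwt : (w : ℤ) ∣ t - 1 := by
      refine (isCoprime_natCast_of_forall_prime fun q hq hqw hqS => ?_).symm.dvd_of_dvd_mul_left
        ((Int.natCast_dvd_natCast.2 (dvd_mul_left w _)).trans htp)
      have := key q hq (dvd_mul_of_dvd_right hqw _) hqS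
      subst this
      exact (Nat.not_even_iff_odd.2 hw) (even_iff_two_dvd.2 hqw)
    have h2w : IsCoprime (2 : ℤ) w := by
      exact_mod_cast Nat.isCoprime_iff_coprime.2 hw.coprime_two_left
    have h3 : (2 : ℤ) * w ∣ t - 1 := h2w.mul_dvd hpt hwt
    have h4 : (((2 ^ a * w : ℕ) : ℤ)) ∣ 2 * (2 * w) := by
      rw [← mul_assoc]
      push_cast
      exact mul_dvd_mul_right (pow_dvd_pow (2 : ℤ) (show a ≤ 2 by omega)) _
    exact h4.trans (mul_dvd_mul_left 2 h3)
  · have hS : (p : ℤ) ^ 2 ∣ ∑ i ∈ range p, t ^ i - p := by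
      rcases hp.eq_two_or_odd' with rfl | hodd
      · exact dvd_geom_sum_sub (by simpa using h8 (by tauto)) 2
      · obtain ⟨b, hb⟩ := hpt
        have := odd_sq_dvd_geom_sum₂_sub (a := (1 : ℤ)) (b := b) hodd
        rw [← hb] at this
        simpa using this
    obtain ⟨s, hs⟩ : (p : ℤ) ∣ ∑ i ∈ range p, t ^ i := by
      have := (dvd_pow_self (p : ℤ) two_ne_zero).trans hS
      exact (dvd_sub_self_right).1 this
    have hp0 : (p : ℤ) ≠ 0 := by exact_mod_cast hp.ne_zero
    rw [hs, mul_comm (p : ℤ) s, mul_assoc] at htp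
    refine (isCoprime_natCast_of_forall_prime fun q hq hqv hqs => ?_).symm.dvd_of_dvd_mul_left htp
    have hqp := key q hq hqv (hs ▸ dvd_mul_of_dvd_right hqs _)
    subst hqp
    rw [hs, sq, show (q : ℤ) * s - q = q * (s - 1) by ring] at hS
    have h5 := Int.dvd_of_mul_dvd_mul_left hp0 hS
    have h6 : (q : ℤ) ∣ 1 := by simpa using dvd_sub hqs h5
    exact hq.one_lt.ne' (by exact_mod_cast Int.eq_one_of_dvd_one (by positivity) h6)

/-! ### From a fixed exponent to invariance outside a subgroup -/

section Multiplier

variable {G : Type*} [CommGroup G] [Fintype G]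

theorem zpow_eq_one_of_card_dvd {k : ℤ} (h : (Fintype.card G : ℤ) ∣ k) (x : G) : x ^ k = 1 :=
  orderOf_dvd_iff_zpow_eq_one.1 ((Int.natCast_dvd_natCast.2 orderOf_dvd_card).trans h)

/-- A nontrivial difference set in a cyclic group of order `v` is not fixed by an exponent `t`
congruent to `1` modulo a prime `p` and modulo `v / p`, but not modulo `v`. -/
theorem order_le_one_of_forall_zpow_mem [DecidableEq G] [IsCyclic G] {D : Finset G} {l : ℤ}
    (hl : ∀ g ≠ 1, (correlation D g : ℤ) = l) {t : ℤ} (htD : ∀ x ∈ D, x ^ t ∈ D) {p : ℕ}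
    (hp : p.Prime) (h1 : (Fintype.card G : ℤ) ∣ p * (t - 1)) (h2 : (p : ℤ) ∣ t - 1)
    (h3 : ¬ (Fintype.card G : ℤ) ∣ t - 1) : (#D : ℤ) - l ≤ 1 := by
  have hsq : (Fintype.card G : ℤ) ∣ (t - 1) * (t - 1) := h1.trans (mul_dvd_mul_right h2 _)
  obtain ⟨h, hh⟩ := IsCyclic.exists_generator (α := G)
  have hord : orderOf h = Fintype.card G := by
    rw [orderOf_eq_card_of_forall_mem_zpowers hh, Nat.card_eq_fintype_card]
  set ψ : G →* G := zpowGroupHom (t - 1) with hψ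
  have hψx (x : G) : ψ x = x ^ (t - 1) := rfl
  set c := ψ h with hcdef
  have hc1 : c ≠ 1 := by
    rw [hcdef, hψx, ne_eq, ← orderOf_dvd_iff_zpow_eq_one, hord]
    exact h3
  have hψp (x : G) : ψ x ^ p = 1 := by
    rw [hψx, ← zpow_natCast, ← zpow_mul, mul_comm]
    exact zpow_eq_one_of_card_dvd h1 x
  have hψψ (x : G) : ψ (ψ x) = 1 := by
    rw [hψx, hψx, ← zpow_mul]
    exact zpow_eq_one_of_card_dvd hsq x
  have := Fact.mk hp
  have hordc : orderOf c = p := orderOf_eq_prime (hψp h) hc1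
  have hrange : ψ.range = Subgroup.zpowers c := by
    ext y
    rw [MonoidHom.mem_range, Subgroup.mem_zpowers_iff]
    constructor
    · rintro ⟨x, rfl⟩
      obtain ⟨j, rfl⟩ := Subgroup.mem_zpowers_iff.1 (hh x)
      exact ⟨j, (map_zpow ψ h j).symm⟩
    · rintro ⟨j, rfl⟩
      exact ⟨h ^ j, map_zpow ψ h j⟩
  have hcard : Nat.card ψ.ker * p = Fintype.card G := by
    rw [← Nat.card_eq_fintype_card, ← ψ.ker.card_mul_index, Subgroup.index_ker, hrange,
      Nat.card_zpowers, hordc]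
  have hcker : c ∈ ψ.ker := hψψ h
  have hinv1 (x : G) (hx : x ∉ ψ.ker) (hxD : x ∈ D) : c * x ∈ D := by
    have hd : orderOf (ψ x) = p := orderOf_eq_prime (hψp x) hx
    have hle : Subgroup.zpowers (ψ x) = Subgroup.zpowers c := by
      refine Subgroup.eq_of_le_of_card_ge ?_ ?_
      · rw [Subgroup.zpowers_le, ← hrange]
        exact ⟨x, rfl⟩
      · rw [Nat.card_zpowers, Nat.card_zpowers, hd, hordc]
    have hc : c ∈ Submonoid.powers (ψ x) := by
      rw [mem_powers_iff_mem_zpowers, hle]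
      exact Subgroup.mem_zpowers c
    obtain ⟨j, hj⟩ := hc
    simp only at hj
    -- Because x^t = ψ(x) x and ψ² is trivial, iterating t multiplies x by successive powers of
    -- ψ(x), which generates the same group as c.
    have hstep (i : ℕ) : ψ x ^ i * x ∈ D := by
      induction i with
      | zero => simpa using hxD
      | succ i ih =>
        have h4 := htD _ ih
        have h5 (y : G) : y ^ t = ψ y * y := by
          rw [hψx, ← zpow_add_one, sub_add_cancel]
        rw [h5, map_mul, map_pow, hψψ, one_pow, one_mul, ← mul_assoc, ← pow_succ'] at h4
        exact h4
    rw [← hj]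
    exact hstep j
  have hinv (x : G) (hx : x ∉ ψ.ker) : c * x ∈ D ↔ x ∈ D := by
    refine ⟨fun hcx => ?_, hinv1 x hx⟩
    have hstep (i : ℕ) : c ^ i * (c * x) ∈ D := by
      induction i with
      | zero => simpa using hcx
      | succ i ih =>
        rw [pow_succ', mul_assoc]
        refine hinv1 _ ?_ ih
        rw [ψ.ker.mul_mem_cancel_left (ψ.ker.pow_mem hcker i), ψ.ker.mul_mem_cancel_left hcker]
        exact hx
    have := hstep (p - 1)
    rwa [← mul_assoc, ← pow_succ, Nat.sub_add_cancel hp.one_le, hψp, one_mul] at this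
  rcases hp.eq_two_or_odd' with rfl | hodd
  · obtain ⟨g, hg⟩ := (Subgroup.isCyclic_iff_exists_zpowers_eq_top ψ.ker).1 inferInstance
    rw [← hg] at hinv hcker hcard
    refine order_le_one_of_two_mul_card_eq hl g ?_ hcker hc1 ?_ hinv
    · rw [← hcard, Nat.card_zpowers, mul_comm]
    · rw [← sq]
      exact hψp h
  · refine order_le_one_of_three_mul_card_le hl ψ.ker ?_ hcker hc1 hinv
    rw [← hcard, mul_comm]
    refine Nat.mul_le_mul_left _ ?_
    have := hp.two_le
    obtain ⟨q, hq⟩ := hodd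
    omega

end Multiplier

/-! ### Reduction of the multiplier group modulo N -/

theorem IsMultiplier.exists_correlation_eq {G : Type*} [CommGroup G] [Fintype G]
    [DecidableEq G] {D : Finset G} {v k l : ℕ} (hD : IsDifferenceSet D v k l) (hn : 1 < (k : ℤ) - l) {t : ℤ} (ht : IsMultiplier D t) :
    ∃ D' : Finset G, #D' = k ∧ (∀ g ≠ 1, (correlation D' g : ℤ) = l) ∧ ∀ x ∈ D', x ^ t ∈ D' := by
  rw [← hD.card_set] at hn ⊢
  exact ht.exists_fixed_translate (fun g hg => by rw [hD.correlation_eq hg]) (by linarith)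

theorem intCast_eq_unitsMap {m N : ℕ} (hN : N ∣ m) {u : (ZMod m)ˣ} {t : ℤ}
    (ht : (t : ZMod m) = u) : (t : ZMod N) = ZMod.unitsMap hN u := by
  rw [ZMod.unitsMap_val, ← ht, ZMod.cast_intCast hN]

/-- An odd prime dividing t + 1 cannot divide t - 1, which settles the odd part of `e`; the 2-part
is at most 2 and is covered by `N`. -/
theorem dvd_add_one_of_dvd_mul {e N : ℕ} (h4 : ¬ 4 ∣ e)
    (hprime : ∀ q : ℕ, q.Prime → q ∣ e → q ∣ N) {t : ℤ} (htN : (N : ℤ) ∣ t + 1)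
    (htsq : (e : ℤ) ∣ (t - 1) * (t + 1)) : (e : ℤ) ∣ t + 1 := by
  have hv : e ≠ 0 := fun h => h4 (h ▸ dvd_zero 4)
  obtain ⟨a, w, hw, rfl⟩ := Nat.exists_eq_two_pow_mul_odd hv
  have ha : a < 2 := by
    by_contra! ha
    exact h4 (dvd_mul_of_dvd_left (pow_dvd_pow 2 ha) w)
  have hwt : (w : ℤ) ∣ t + 1 := by
    refine (isCoprime_natCast_of_forall_prime fun q hq hqw hqt => ?_).symm.dvd_of_dvd_mul_left
      ((Int.natCast_dvd_natCast.2 (dvd_mul_left w _)).trans htsq)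
    have h1 := (Int.natCast_dvd_natCast.2 (hprime q hq (dvd_mul_of_dvd_right hqw _))).trans htN
    have h2 : (q : ℤ) ∣ (2 : ℕ) := by
      have := dvd_sub h1 hqt
      rwa [show t + 1 - (t - 1) = (2 : ℕ) by push_cast; ring] at this
    rw [Int.natCast_dvd_natCast, Nat.prime_dvd_prime_iff_eq hq Nat.prime_two] at h2
    subst h2
    exact (Nat.not_even_iff_odd.2 hw) (even_iff_two_dvd.2 hqw)
  interval_cases a
  · simpa using hwt
  · have h2 := (Int.natCast_dvd_natCast.2 (hprime 2 Nat.prime_two (by simp))).trans htN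
    have h2w : IsCoprime ((2 : ℕ) : ℤ) w := Nat.isCoprime_iff_coprime.2 hw.coprime_two_left
    simpa using h2w.mul_dvd h2 hwt

section MultiplierGroup

variable {G : Type*} [CommGroup G] [Finite G] [IsCyclic G] {D : Finset G} {v k l : ℕ}

/-- A multiplier of a nontrivial cyclic difference set is determined by its residue modulo any
divisor of the order having the same prime divisors, and divisible by `4` if the order is
divisible by `8`. -/
theorem eq_one_of_mem_multiplierGroup (hD : IsDifferenceSet D v k l) (hn : 1 < (k : ℤ) - l)
    {N : ℕ} (hN : N ∣ Monoid.exponent G)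
    (hprime : ∀ q : ℕ, q.Prime → q ∣ Monoid.exponent G → q ∣ N)
    (h8 : 8 ∣ Monoid.exponent G → 4 ∣ N) {u : (ZMod (Monoid.exponent G))ˣ}
    (hu : u ∈ multiplierGroup D) (huN : ZMod.unitsMap hN u = 1) : u = 1 := by
  classical
  have := Fintype.ofFinite G
  have hexp : Monoid.exponent G = Fintype.card G := by
    rw [IsCyclic.exponent_eq_card, Nat.card_eq_fintype_card]
  have : NeZero (Monoid.exponent G) := ⟨by rw [hexp]; exact Fintype.card_ne_zero⟩
  by_contra hu1
  obtain ⟨p, hp, hpu⟩ := Nat.exists_prime_and_dvd (mt orderOf_eq_one_iff.1 hu1)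
  set w := u ^ (orderOf u / p) with hw
  have hwp : orderOf w = p := orderOf_pow_orderOf_div (orderOf_pos u).ne' hpu
  have hwM : w ∈ multiplierGroup D := Subgroup.pow_mem _ hu _
  have hwN : ZMod.unitsMap hN w = 1 := by rw [hw, map_pow, huN, one_pow]
  obtain ⟨t, ht⟩ := ZMod.intCast_surjective (w : ZMod (Monoid.exponent G))
  have htN : (N : ℤ) ∣ t - 1 := by
    rw [← ZMod.intCast_zmod_eq_zero_iff_dvd]
    push_cast
    rw [intCast_eq_unitsMap hN ht, hwN, Units.val_one, sub_self]
  have htp : (Monoid.exponent G : ℤ) ∣ t ^ p - 1 := by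
    rw [← ZMod.intCast_zmod_eq_zero_iff_dvd]
    push_cast
    rw [ht, ← Units.val_pow_eq_pow_val, ← hwp, pow_orderOf_eq_one, Units.val_one, sub_self]
  have ht1 : ¬ (Monoid.exponent G : ℤ) ∣ t - 1 := by
    rw [← ZMod.intCast_zmod_eq_zero_iff_dvd]
    push_cast
    rw [ht, sub_eq_zero, Units.val_eq_one, ← orderOf_eq_one_iff, hwp]
    exact hp.ne_one
  obtain ⟨h1, h2⟩ := dvd_prime_mul_sub_one (NeZero.ne _) hp
    (fun q hq hqv => (Int.natCast_dvd_natCast.2 (hprime q hq hqv)).trans htN)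
    (fun h => (Int.natCast_dvd_natCast.2 (h8 h)).trans htN) htp ht1
  obtain ⟨D', hD', hl, htD⟩ :=
    ((mem_multiplierGroup_iff D ht).1 hwM).exists_correlation_eq hD hn
  rw [hexp] at h1 ht1
  have := order_le_one_of_forall_zpow_mem hl htD hp h1 h2 ht1
  rw [hD'] at this
  exact absurd this hn.not_ge

/-- `-1` is not a multiplier of a nontrivial difference set in a finite cyclic group. -/
theorem not_isMultiplier_neg_one (hD : IsDifferenceSet D v k l) (hn : 1 < (k : ℤ) - l) :
    ¬ IsMultiplier D (-1) := by
  classical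
  have := Fintype.ofFinite G
  intro h
  obtain ⟨D', hD', hl, htD⟩ := h.exists_correlation_eq hD hn
  simp only [zpow_neg_one] at htD
  refine hn.not_ge ?_
  rw [← hD']
  rcases Nat.even_or_odd (Fintype.card G) with he | ho
  · obtain ⟨h, hh⟩ := IsCyclic.exists_generator (α := G)
    obtain ⟨m, hm⟩ := even_iff_two_dvd.1 he
    refine order_le_one_of_forall_inv_mem_of_even hl htD hh (m := m) ?_
    rw [orderOf_eq_card_of_forall_mem_zpowers hh, Nat.card_eq_fintype_card, hm]
  · have hcard : 1 < Fintype.card G := by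
      have := Finset.card_le_univ D'
      omega
    have := Fintype.one_lt_card_iff_nontrivial.1 hcard
    obtain ⟨c, hc⟩ := exists_ne (1 : G)
    exact order_le_one_of_forall_inv_mem_of_odd hl htD ho hc

/-- The square of such a `u` reduces to 1, hence equals 1 by injectivity; as 4 ∤ v this makes `u`
itself -1, which is not a multiplier. -/
theorem unitsMap_ne_neg_one_of_mem_multiplierGroup (hD : IsDifferenceSet D v k l)
    (hn : 1 < (k : ℤ) - l) (h4 : ¬ 4 ∣ Monoid.exponent G) {N : ℕ} (hN : N ∣ Monoid.exponent G)
    (hprime : ∀ q : ℕ, q.Prime → q ∣ Monoid.exponent G → q ∣ N)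
    {u : (ZMod (Monoid.exponent G))ˣ} (hu : u ∈ multiplierGroup D) :
    ZMod.unitsMap hN u ≠ -1 := by
  intro huN
  have husq : u * u = 1 := by
    refine eq_one_of_mem_multiplierGroup hD hn hN hprime
      (fun h8 => absurd (dvd_trans (by norm_num) h8) h4) (mul_mem hu hu) ?_
    rw [map_mul, huN, neg_mul_neg, one_mul]
  obtain ⟨t, ht⟩ := ZMod.intCast_surjective (u : ZMod (Monoid.exponent G))
  have htN : (N : ℤ) ∣ t + 1 := by
    rw [← ZMod.intCast_zmod_eq_zero_iff_dvd]
    push_cast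
    rw [intCast_eq_unitsMap hN ht, huN, Units.val_neg, Units.val_one, neg_add_cancel]
  have htsq : (Monoid.exponent G : ℤ) ∣ (t - 1) * (t + 1) := by
    rw [← ZMod.intCast_zmod_eq_zero_iff_dvd]
    push_cast
    rw [ht, mul_comm, ← mul_self_sub_one, ← Units.val_mul, husq, Units.val_one, sub_self]
  have hdvd := dvd_add_one_of_dvd_mul h4 hprime htN htsq
  refine not_isMultiplier_neg_one hD hn
    ((mem_multiplierGroup_iff D (u := u) ?_).1 hu)
  rw [← ht, ← sub_eq_zero, ← Int.cast_sub, ZMod.intCast_zmod_eq_zero_iff_dvd, ← dvd_neg]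
  simpa [add_comm] using hdvd

end MultiplierGroup

/-! ### Embeddings and cardinalities -/

theorem exists_subgroup_mulEquiv_and_card_le {M K : Type*} [Group M] [Group K] [Finite K]
    (f : M →* K) (hf : Function.Injective f) :
    (∃ H : Subgroup K, Nonempty (M ≃* H)) ∧ Nat.card M ≤ Nat.card K :=
  ⟨⟨f.range, ⟨MonoidHom.ofInjective hf⟩⟩, Nat.card_le_card_of_injective f hf⟩

theorem two_mul_radical_dvd {n : ℕ} (h : 4 ∣ n) :
    2 * UniqueFactorizationMonoid.radical n ∣ n := by
  rcases eq_or_ne n 0 with rfl | hn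
  · exact dvd_zero _
  obtain ⟨m, rfl⟩ := h
  rw [show 4 * m = 2 * (2 * m) by ring]
  refine mul_dvd_mul_left 2 ?_
  rw [Nat.radical_dvd_iff (by omega), Nat.primeFactors_mul two_ne_zero (by omega),
    Nat.Prime.primeFactors Nat.prime_two]
  refine Finset.union_subset ?_ subset_rfl
  rw [Finset.singleton_subset_iff, Nat.mem_primeFactors]
  exact ⟨Nat.prime_two, dvd_mul_right 2 m, by omega⟩

end

theorem mainTheorem4 {G : Type*} [CommGroup G] [Finite G] [IsCyclic G] (D : Finset G)
    (v k l : ℕ) (hD : IsDifferenceSet D v k l) (hnontrivial : 1 < (k : ℤ) - (l : ℤ)) :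
    (¬ v ≡ 0 [MOD 4] →
      (∃ H : Subgroup ((ZMod (UniqueFactorizationMonoid.radical v))ˣ ⧸
          Subgroup.zpowers (-1 : (ZMod (UniqueFactorizationMonoid.radical v))ˣ)),
        Nonempty (multiplierGroup D ≃* H)) ∧
      (Nat.card (multiplierGroup D) : ℝ) ≤
        (Nat.totient (UniqueFactorizationMonoid.radical v) : ℝ) / 2) ∧
    (v ≡ 0 [MOD 4] →
      (∃ H : Subgroup (ZMod (multiplierConst v * UniqueFactorizationMonoid.radical v))ˣ,
        Nonempty (multiplierGroup D ≃* H)) ∧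
      Nat.card (multiplierGroup D) ≤
        multiplierConst v * Nat.totient (UniqueFactorizationMonoid.radical v)) := by
  obtain rfl : Monoid.exponent G = v := by rw [IsCyclic.exponent_eq_card, hD.card_group]
  have hv0 : Monoid.exponent G ≠ 0 := by
    rw [IsCyclic.exponent_eq_card]
    exact Nat.card_pos.ne'
  rw [Nat.modEq_zero_iff_dvd]
  have hrad := UniqueFactorizationMonoid.radical_dvd_self (a := Monoid.exponent G)
  have hprime (q : ℕ) (hq : q.Prime) (hqv : q ∣ Monoid.exponent G) :
      q ∣ UniqueFactorizationMonoid.radical (Monoid.exponent G) :=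
    (UniqueFactorizationMonoid.dvd_radical_iff_of_irreducible hq.prime.irreducible hv0).2 hqv
  have hrad0 : NeZero (UniqueFactorizationMonoid.radical (Monoid.exponent G)) :=
    ⟨UniqueFactorizationMonoid.radical_ne_zero⟩
  refine ⟨fun h4 => ?_, fun h4 => ?_⟩
  · let f := (QuotientGroup.mk' (Subgroup.zpowers
        (-1 : (ZMod (UniqueFactorizationMonoid.radical (Monoid.exponent G)))ˣ))).comp
      ((ZMod.unitsMap hrad).comp (multiplierGroup D).subtype)
    have hf : Function.Injective f := by
      rw [injective_iff_map_eq_one]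
      rintro ⟨u, hu⟩ hfu
      have h1 : ZMod.unitsMap hrad u ∈ Subgroup.zpowers (-1) := (QuotientGroup.eq_one_iff _).1 hfu
      obtain ⟨j, hj⟩ := Subgroup.mem_zpowers_iff.1 h1
      rcases Int.even_or_odd j with hj' | hj'
      · rw [hj'.neg_one_zpow] at hj
        exact Subtype.ext (eq_one_of_mem_multiplierGroup hD hnontrivial hrad hprime
          (fun h8 => absurd (dvd_trans (by norm_num) h8) h4) hu hj.symm)
      · rw [hj'.neg_one_zpow] at hj
        exact absurd hj.symm
          (unitsMap_ne_neg_one_of_mem_multiplierGroup hD hnontrivial h4 hrad hprime hu)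
    obtain ⟨h1, h2⟩ := exists_subgroup_mulEquiv_and_card_le f hf
    refine ⟨h1, ?_⟩
    -- Otherwise the trivial multiplier would reduce to -1. This makes the quotient exactly half as
    -- large.
    have h3 : (-1 : (ZMod (UniqueFactorizationMonoid.radical (Monoid.exponent G)))ˣ) ≠ 1 := by
      intro h3
      refine unitsMap_ne_neg_one_of_mem_multiplierGroup hD hnontrivial h4 hrad hprime
        (one_mem (multiplierGroup D)) ?_
      rw [map_one, h3]
    have h4 := Subgroup.card_eq_card_quotient_mul_card_subgroup (Subgroup.zpowers
        (-1 : (ZMod (UniqueFactorizationMonoid.radical (Monoid.exponent G)))ˣ))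
    rw [Nat.card_zpowers, orderOf_eq_prime (p := 2) (by simp) h3, Nat.card_eq_fintype_card,
      ZMod.card_units_eq_totient] at h4
    rw [h4, le_div_iff₀ two_pos]
    exact_mod_cast Nat.mul_le_mul_right 2 h2
  · have h2 : 2 ∣ UniqueFactorizationMonoid.radical (Monoid.exponent G) :=
      hprime 2 Nat.prime_two (dvd_trans (by norm_num) h4)
    have hN : multiplierConst (Monoid.exponent G) *
        UniqueFactorizationMonoid.radical (Monoid.exponent G) ∣ Monoid.exponent G := by
      unfold multiplierConst
      split_ifs
      · exact two_mul_radical_dvd h4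
      · rwa [one_mul]
    have hcard : Nat.card (ZMod (multiplierConst (Monoid.exponent G) *
        UniqueFactorizationMonoid.radical (Monoid.exponent G)))ˣ =
        multiplierConst (Monoid.exponent G) *
        Nat.totient (UniqueFactorizationMonoid.radical (Monoid.exponent G)) := by
      have : NeZero (multiplierConst (Monoid.exponent G) *
        UniqueFactorizationMonoid.radical (Monoid.exponent G)) :=
        ⟨fun h => hv0 (Nat.eq_zero_of_zero_dvd (h ▸ hN))⟩
      rw [Nat.card_eq_fintype_card, ZMod.card_units_eq_totient]
      unfold multiplierConst
      split_ifs
      -- Since 2 already divides rad(v), an extra factor 2 doubles the totient.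
      · exact Nat.totient_mul_of_prime_of_dvd Nat.prime_two h2
      · rw [one_mul, one_mul]
    have : Finite (ZMod (multiplierConst (Monoid.exponent G) *
        UniqueFactorizationMonoid.radical (Monoid.exponent G)))ˣ := by
      refine Nat.finite_of_card_ne_zero ?_
      rw [hcard]
      unfold multiplierConst
      have := Nat.totient_pos.2 (NeZero.pos
        (UniqueFactorizationMonoid.radical (Monoid.exponent G)))
      split_ifs <;> omega
    rw [← hcard]
    refine exists_subgroup_mulEquiv_and_card_le
      ((ZMod.unitsMap hN).comp (multiplierGroup D).subtype) ?_
    rw [injective_iff_map_eq_one]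
    rintro ⟨u, hu⟩ hfu
    refine Subtype.ext (eq_one_of_mem_multiplierGroup hD hnontrivial hN
      (fun q hq hqv => dvd_mul_of_dvd_right (hprime q hq hqv) _) (fun h8 => ?_) hu hfu)
    rw [multiplierConst, if_pos h8]
    exact mul_dvd_mul_left 2 h2
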